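/- Let $K$ be a field (for instance $K=\mathbb C$ or $\mathbb C(q)$), let $q\in K$, $q\neq 0$, and let $m,n\ge 0$. Put $\bar i=0$ for $1\le i\le m$, $\bar i=1$ for $m<i\le m+n$, and $\varepsilon(a)=1,0,-1$ according as $a>0$, $a=0$, $a<0$. Call an $(m+n)\times(m+n)$ matrix $A$ over a $K$-algebra a *$q$-super Manin matrix of type $m|n$* if for all indices $$A_{ij}^2=0\ \text{ if }\bar i=1,\bar j=0;$$ $$A_{ik}A_{il}=q^{\varepsilon(l-k)}(-1)^{(\bar k+1)(\bar l+1)}A_{il}A_{ik}\ \text{ if }\bar i=1;\qquad A_{ik}A_{jk}=q^{\varepsilon(i-j)}(-1)^{\bar i\bar j}A_{jk}A_{ik}\ \text{ if }\bar k=0;$$ $$A_{ij}A_{kl}-q^{\varepsilon(i-k)+\varepsilon(l-j)}(-1)^{(\bar i+\bar j)(\bar k+\bar l)}A_{kl}A_{ij}=q^{\varepsilon(i-k)}(-1)^{\bar i\bar k+\bar j\bar k+\bar i\bar j}A_{kj}A_{il}-q^{\varepsilon(l-j)}(-1)^{\bar j\bar k+\bar j\bar l+\bar k\bar l}A_{il}A_{kj}.$$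 The supertranspose of a matrix $A$ of type $m|n$ is $(A^{st})_{ij}=(-1)^{\bar i(\bar i+\bar j)}A_{ji}$, and its $\Pi$-transpose is the matrix $A^{\Pi}$ of type $n|m$ with $(A^{\Pi})_{ij}=A_{m+n+1-i,\,m+n+1-j}$; write $A^{\Pi\circ st}=(A^{\Pi})^{st}$, where the supertranspose is that of type $n|m$. Let $\widetilde{\mathcal M}_{m|n}$ be the associative unital $K$-algebra generated by the entries of matrices $\bar M_0,\bar M_1,\bar M_2,\dots$ of size $m+n$ subject to the relations, for all $k\ge 0$ and $d\geq 0$: $\bar M_k$ is a $q$-super Manin matrix of type $m|n$ if $k$ is even and a $q^{-1}$-super Manin matrix if $k$ is odd; $\bar M_k^{st^k}\bar M_{k+1}^{st^k}=\bar M_{k+1}^{st^k}\bar M_k^{st^k}=I$; and $\bar M_{k+2d}=\bar M_k$. Let $M$ be the image of $\bar M_0$, so that $M$ is invertible and $M^{-1}$ is the image of $\bar M_1$. With $l(\sigma)$ the number of inversions of a permutation $\sigma$, define the quantum Berezinian of an invertible $q$-super Manin matrix $A$ of type $m|n$ by $$\mathrm{Ber}_q(A)=\sum_{\sigma\in\mathfrak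 S_m}(-q)^{-l(\sigma)}A_{\sigma(1),1}\cdots A_{\sigma(m),m}\ \times\ \sum_{\rho\in\mathfrak S_n}(-q)^{-l(\rho)}(A^{-1})_{m+1,m+\rho(1)}\cdots(A^{-1})_{m+n,m+\rho(n)},$$ and that of an invertible $q^{-1}$-super Manin matrix $B$ of type $m|n$ (for which one uses the opposite coalgebra structure, so that the two factors appear in the other order) by $$\mathrm{Ber}_{q^{-1}}(B)=\sum_{\rho\in\mathfrak S_n}(-q)^{l(\rho)}(B^{-1})_{m+1,m+\rho(1)}\cdots(B^{-1})_{m+n,m+\rho(n)}\ \times\ \sum_{\sigma\in\mathfrak S_m}(-q)^{l(\sigma)}B_{\sigma(1),1}\cdots B_{\sigma(m),m};$$ for matrices of type $n|m$ exchange $m$ and $n$ in these formulas. **Corollary 4.5.** The matrices $M$ and $(M^{-1})^{\Pi\circ st}$ over $\widetilde{\mathcal M}_{m|n}$ are invertible, and the quantum Berezinian of $M$ (of type $m|n$) equals the $q^{-1}$-Berezinian of the matrix $(M^{-1})^{\Pi\circ st}$ (of type $n|m$): $$\mathrm{Ber}_q(M)=\mathrm{Ber}_{q^{-1}}\big((M^{-1})^{\Pi\circ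 st}\big).$$ -/

import Mathlib

section QuantumSuper

variable {K : Type*} [Field K]

/-- The parity of the index `i` in `{1, …, m+n}` (here `Fin (m + n)`, counted from `0`):
the first `m` indices are even, the last `n` are odd. -/
def parity (m n : ℕ) (i : Fin (m + n)) : ℕ := if (i : ℕ) < m then 0 else 1

/-- `eps a b` is the sign of `a - b`, that is `1`, `0` or `-1`. -/
def eps {N : ℕ} (a b : Fin N) : ℤ := Int.sign ((a : ℤ) - (b : ℤ))

/-- The number of inversions (the length) of a permutation. -/
def permLength {k : ℕ} (σ : Equiv.Perm (Fin k)) : ℕ :=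
  (Finset.univ.filter fun p : Fin k × Fin k => p.1 < p.2 ∧ σ p.2 < σ p.1).card

/-- The supertranspose of a matrix of type `m|n`: the `(i,j)` entry of `A^{st}` is
`(-1)^{|i|(|i|+|j|)} A_{ji}`. -/
def superTranspose (m n : ℕ) {R : Type*} [Ring R]
    (A : Matrix (Fin (m + n)) (Fin (m + n)) R) : Matrix (Fin (m + n)) (Fin (m + n)) R :=
  Matrix.of fun i j => (-1 : R) ^ (parity m n i * (parity m n i + parity m n j)) * A j i

/-- The `Π`-transpose of a matrix of type `m|n`, a matrix of type `n|m`: the order of the rows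
and the order of the columns are reversed.  In blocks it sends `(M₁₁, M₁₂; M₂₁, M₂₂)` to
`(π(M₂₂), π(M₂₁); π(M₁₂), π(M₁₁))`, where `π` reverses the rows and the columns of a block. -/
def piTranspose (m n : ℕ) {R : Type*}
    (A : Matrix (Fin (m + n)) (Fin (m + n)) R) : Matrix (Fin (n + m)) (Fin (n + m)) R :=
  Matrix.of fun i j =>
    A (Fin.cast (Nat.add_comm n m) i).rev (Fin.cast (Nat.add_comm n m) j).rev

/-- The matrix `M̄ₖ` of free generators of the free algebra on the entries of
`M̄₀, M̄₁, M̄₂, …`. -/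
def freeGen (K : Type*) [Field K] (m n k : ℕ) :
    Matrix (Fin (m + n)) (Fin (m + n))
      (FreeAlgebra K (ℕ × Fin (m + n) × Fin (m + n))) :=
  Matrix.of fun i j => FreeAlgebra.ι K (k, i, j)

/-- The parameter of the quadratic relations satisfied by `M̄ₖ`: it is `q` for even `k` and
`q⁻¹` for odd `k`, because the graded anti-homomorphism `M̄ₖ ↦ M̄ₖ₊₁` turns the quadratic
relations for the parameter `q` into those for `q⁻¹`, and conversely. -/
noncomputable def levelParam (q : K) (k : ℕ) : K := if Even k then q else q⁻¹

/-- The defining relations of the Hopf superalgebra generated by the entries of the matrices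
`M̄ₖ`.  `oddSq`, `row`, `col`, `cross` are the quadratic relations which say that `M̄ₖ` is a
super Manin matrix for the parameter `levelParam q k`. -/
inductive HopfRel (q : K) (m n : ℕ) :
    FreeAlgebra K (ℕ × Fin (m + n) × Fin (m + n)) →
    FreeAlgebra K (ℕ × Fin (m + n) × Fin (m + n)) → Prop
  | oddSq (t : ℕ) (i j : Fin (m + n)) (hi : parity m n i = 1) (hj : parity m n j = 0) :
      HopfRel q m n (freeGen K m n t i j ^ 2) 0
  | row (t : ℕ) (i k l : Fin (m + n)) (hi : parity m n i = 1) :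
      HopfRel q m n (freeGen K m n t i k * freeGen K m n t i l)
        ((levelParam q t ^ eps l k * (-1) ^ ((parity m n k + 1) * (parity m n l + 1))) •
          (freeGen K m n t i l * freeGen K m n t i k))
  | col (t : ℕ) (i j k : Fin (m + n)) (hk : parity m n k = 0) :
      HopfRel q m n (freeGen K m n t i k * freeGen K m n t j k)
        ((levelParam q t ^ eps i j * (-1) ^ (parity m n i * parity m n j)) •
          (freeGen K m n t j k * freeGen K m n t i k))
  | cross (t : ℕ) (i j k l : Fin (m + n)) :
      HopfRel q m n
        (freeGen K m n t i j * freeGen K m n t k l -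
          (levelParam q t ^ (eps i k + eps l j) *
              (-1) ^ ((parity m n i + parity m n j) * (parity m n k + parity m n l))) •
            (freeGen K m n t k l * freeGen K m n t i j))
        ((levelParam q t ^ eps i k *
              (-1) ^ (parity m n i * parity m n k + parity m n j * parity m n k +
                parity m n i * parity m n j)) •
            (freeGen K m n t k j * freeGen K m n t i l) -
          (levelParam q t ^ eps l j *
              (-1) ^ (parity m n j * parity m n k + parity m n j * parity m n l +
                parity m n k * parity m n l)) •
            (freeGen K m n t i l * freeGen K m n t k j))
  | mulInv (t : ℕ) (i j : Fin (m + n)) :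
      HopfRel q m n
        (((superTranspose m n)^[t] (freeGen K m n t) *
          (superTranspose m n)^[t] (freeGen K m n (t + 1))) i j)
        ((1 : Matrix (Fin (m + n)) (Fin (m + n)) _) i j)
  | invMul (t : ℕ) (i j : Fin (m + n)) :
      HopfRel q m n
        (((superTranspose m n)^[t] (freeGen K m n (t + 1)) *
          (superTranspose m n)^[t] (freeGen K m n t)) i j)
        ((1 : Matrix (Fin (m + n)) (Fin (m + n)) _) i j)
  | periodic (t d : ℕ) (i j : Fin (m + n)) :
      HopfRel q m n (freeGen K m n t i j) (freeGen K m n (t + 2 * d) i j)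

/-- The Hopf envelope of the right quantum superalgebra of type `m|n` with parameter `q`
(as an algebra), with the additional relations `M̄ₖ = M̄ₖ₊₂d`. -/
def QuantumSuperHopf (q : K) (m n : ℕ) : Type _ := RingQuot (HopfRel q m n)

noncomputable instance (q : K) (m n : ℕ) : Ring (QuantumSuperHopf q m n) :=
  inferInstanceAs (Ring (RingQuot (HopfRel q m n)))

noncomputable instance (q : K) (m n : ℕ) : Algebra K (QuantumSuperHopf q m n) :=
  inferInstanceAs (Algebra K (RingQuot (HopfRel q m n)))

/-- The projection of the free algebra onto the Hopf envelope. -/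
noncomputable def hopfProj (q : K) (m n : ℕ) :
    FreeAlgebra K (ℕ × Fin (m + n) × Fin (m + n)) →ₐ[K] QuantumSuperHopf q m n :=
  RingQuot.mkAlgHom K (HopfRel q m n)

/-- The generator matrix `M`, the image of `M̄₀`, of the Hopf envelope. -/
noncomputable def genMatrix (q : K) (m n : ℕ) :
    Matrix (Fin (m + n)) (Fin (m + n)) (QuantumSuperHopf q m n) :=
  (freeGen K m n 0).map (hopfProj q m n)

variable {R : Type*} [Ring R] [Algebra K R]

/-- The factor `∑_σ (-q)^{-l(σ)} A_{σ(1),1} ⋯ A_{σ(m),m}` (`σ` in the symmetric group of degree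
`m`) formed from the even-even block of a matrix `A` of type `m|n`. -/
noncomputable def evenDet (q : K) (m n : ℕ) (A : Matrix (Fin (m + n)) (Fin (m + n)) R) : R :=
  ∑ σ : Equiv.Perm (Fin m), (-q) ^ (-(permLength σ : ℤ)) •
    (List.ofFn fun i : Fin m => A (Fin.castAdd n (σ i)) (Fin.castAdd n i)).prod

/-- The factor `∑_ρ (-q)^{-l(ρ)} A_{m+1,m+ρ(1)} ⋯ A_{m+n,m+ρ(n)}` (`ρ` in the symmetric group of
degree `n`) formed from the odd-odd block of a matrix `A` of type `m|n`. -/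
noncomputable def oddDet (q : K) (m n : ℕ) (A : Matrix (Fin (m + n)) (Fin (m + n)) R) : R :=
  ∑ ρ : Equiv.Perm (Fin n), (-q) ^ (-(permLength ρ : ℤ)) •
    (List.ofFn fun j : Fin n => A (Fin.natAdd m j) (Fin.natAdd m (ρ j))).prod

/-- The quantum Berezinian `Ber_q(M)` of a `q`-super Manin matrix `M` of type `m|n`.
`Ring.inverse M` is the two-sided inverse `M⁻¹` in the ring of matrices. -/
noncomputable def qBer (q : K) (m n : ℕ) (M : Matrix (Fin (m + n)) (Fin (m + n)) R) : R :=
  evenDet q m n M * oddDet q m n (Ring.inverse M)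

/-- The quantum Berezinian `Ber_{q⁻¹}(N)` of a `q⁻¹`-super Manin matrix `N` of type `m|n`.
It comes from the co-opposite coaction, so the factor from `N⁻¹` stands on the left:
`∑_ρ (-q)^{l(ρ)} (N⁻¹)_{m+1,m+ρ(1)} ⋯ (N⁻¹)_{m+n,m+ρ(n)}` times
`∑_σ (-q)^{l(σ)} N_{σ(1),1} ⋯ N_{σ(m),m}`. -/
noncomputable def qInvBer (q : K) (m n : ℕ) (N : Matrix (Fin (m + n)) (Fin (m + n)) R) : R :=
  oddDet q⁻¹ m n (Ring.inverse N) * evenDet q⁻¹ m n N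

end QuantumSuper

/-!
The matrix `N = M⁻¹` of the relations `M N = N M = 1` is the image of `M̄₁`, and periodicity turns
the relations between `M̄₁` and `M̄₂` into the invertibility of `N^{st}`, with inverse `M^{st}`.
Reversing the indices exchanges the two parities, so `(A^Π)^{st}` is `A^{st}` with reversed
indices, conjugated by the diagonal matrix of parity signs (`superTranspose_piTranspose`). Hence
`(N^Π)^{st}` is invertible with inverse `(M^Π)^{st}`.

Both Berezinians are therefore products of a determinant of the even-even block of `M` and a
determinant of the odd-odd block of `N`, in this order. They differ in that the second one
multiplies the columns of `M` (the rows of `N`) in the opposite order and has `q⁻¹` in place of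
`q`. That this does not change either factor is a property of quantum determinants of a square
matrix `A` satisfying the cross relations (`IsCrossManin`): exchanging two neighbouring columns
that stand in increasing order divides the column determinant by `-q` (`colDet_mul_swap`), because
the terms for `σ` and `σ s` combine into a `2 × 2` determinant. Thus a permutation `τ` of the
columns contributes the factor `(-q)^{-l(τ)}` (`colDet_eq`). Taking for `τ` the reversal, and
`l(σ) + l(σ τ) = l(τ)`, gives the equality of the two expansions (`sum_reverse_eq_colDet`).
-/

/-! ### The length of a permutation -/

/-- An adjacent transposition preserves the order of every pair except the one it exchanges. -/
theorem swap_castSucc_succ_lt {N : ℕ} (k : Fin N) {a b : Fin (N + 1)} (hab : a < b)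
    (hne : ¬(a = k.castSucc ∧ b = k.succ)) :
    Equiv.swap k.castSucc k.succ a < Equiv.swap k.castSucc k.succ b := by
  simp only [Fin.ext_iff, Fin.val_castSucc, Fin.val_succ, Fin.lt_def] at hab hne
  simp only [Equiv.swap_apply_def, Fin.ext_iff, Fin.val_castSucc, Fin.val_succ]
  split_ifs <;> simp only [Fin.lt_def, Fin.val_castSucc, Fin.val_succ] <;> omega

theorem permLength_mul_swap {N : ℕ} (σ : Equiv.Perm (Fin (N + 1))) (k : Fin N)
    (h : σ k.castSucc < σ k.succ) :
    permLength (σ * Equiv.swap k.castSucc k.succ) = permLength σ + 1 := by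
  classical
  set s := Equiv.swap k.castSucc k.succ
  have hss : ∀ x, s (s x) = x := Equiv.swap_apply_self _ _
  have hk : s k.castSucc = k.succ := Equiv.swap_apply_left _ _
  have hk' : s k.succ = k.castSucc := Equiv.swap_apply_right _ _
  have hlt : k.castSucc < k.succ := Fin.castSucc_lt_succ
  let S := Finset.univ.filter fun p : Fin (N + 1) × Fin (N + 1) => p.1 < p.2 ∧ σ p.2 < σ p.1
  -- Composing with `s` moves the inversions of `σ` by `s` and adds the inversion `(k, k + 1)`.
  have key : (Finset.univ.filter fun p : Fin (N + 1) × Fin (N + 1) =>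
      p.1 < p.2 ∧ (σ * s) p.2 < (σ * s) p.1) =
      insert (k.castSucc, k.succ) (S.map (Equiv.prodCongr s s).toEmbedding) := by
    ext ⟨a, b⟩
    rw [Finset.mem_filter]
    simp only [Finset.mem_filter, Finset.mem_univ, true_and, Equiv.Perm.mul_apply,
      Finset.mem_insert, Prod.mk.injEq, Finset.mem_map, S, Equiv.coe_toEmbedding,
      Equiv.prodCongr_apply, Prod.exists, Prod.map_apply]
    constructor
    · rintro ⟨hab, hi⟩
      by_cases hne : a = k.castSucc ∧ b = k.succ
      · exact Or.inl hne
      · exact Or.inr ⟨s a, s b, ⟨swap_castSucc_succ_lt k hab hne, hi⟩, hss a, hss b⟩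
    · rintro (⟨rfl, rfl⟩ | ⟨a', b', ⟨hab, hi⟩, rfl, rfl⟩)
      · rw [hk, hk']
        exact ⟨hlt, h⟩
      · rw [hss, hss]
        refine ⟨swap_castSucc_succ_lt k hab ?_, hi⟩
        rintro ⟨rfl, rfl⟩
        exact lt_asymm h hi
  have hnot : (k.castSucc, k.succ) ∉ S.map (Equiv.prodCongr s s).toEmbedding := by
    simp only [Finset.mem_map, S, Equiv.coe_toEmbedding, Finset.mem_filter, Finset.mem_univ,
      true_and, Equiv.prodCongr_apply, Prod.exists, Prod.map_apply, Prod.mk.injEq, not_exists,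
      not_and]
    rintro a b ⟨hab, -⟩ ha hb
    have ha' : a = k.succ := by rw [← hss a, ha, hk]
    have hb' : b = k.castSucc := by rw [← hss b, hb, hk']
    subst ha' hb'
    exact lt_asymm hab hlt
  unfold permLength
  rw [key, Finset.card_insert_of_notMem hnot, Finset.card_map]

/-- A pair of positions is inverted by exactly one of `σ` and the reversed word of `σ`. -/
theorem permLength_add_permLength_mul_rev {r : ℕ} (σ : Equiv.Perm (Fin r)) :
    permLength σ + permLength (σ * Fin.revPerm) = permLength (Fin.revPerm (n := r)) := by
  classical
  have h1 : permLength (σ * Fin.revPerm) = (Finset.univ.filter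
      fun p : Fin r × Fin r => p.1 < p.2 ∧ ¬ σ p.2 < σ p.1).card := by
    unfold permLength
    refine Finset.card_equiv
      ((Equiv.prodComm _ _).trans (Equiv.prodCongr Fin.revPerm Fin.revPerm)) ?_
    rintro ⟨a, b⟩
    simp only [Finset.mem_filter, Finset.mem_univ, true_and, Equiv.Perm.mul_apply,
      Fin.revPerm_apply, Equiv.trans_apply, Equiv.prodComm_apply, Prod.swap_prod_mk,
      Equiv.prodCongr_apply, Prod.map_apply, Fin.rev_lt_rev, not_lt]
    refine and_congr_right fun hab => ⟨le_of_lt, fun h => lt_of_le_of_ne h fun he => ?_⟩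
    exact hab.ne (Fin.rev_injective (σ.injective he)).symm
  have h2 : permLength (Fin.revPerm (n := r)) =
      (Finset.univ.filter fun p : Fin r × Fin r => p.1 < p.2).card := by
    simp [permLength, Fin.rev_lt_rev]
  rw [h1, h2, permLength, ← Finset.filter_filter, ← Finset.filter_filter,
    Finset.card_filter_add_card_filter_not]

theorem permLength_one {r : ℕ} : permLength (1 : Equiv.Perm (Fin r)) = 0 := by
  rw [permLength, Finset.card_eq_zero, Finset.filter_eq_empty_iff]
  exact fun p _ h => lt_asymm h.1 h.2

theorem permLength_rev_mul_mul_rev {r : ℕ} (σ : Equiv.Perm (Fin r)) :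
    permLength (Fin.revPerm * σ * Fin.revPerm) = permLength σ := by
  unfold permLength
  refine Finset.card_equiv
    ((Equiv.prodComm _ _).trans (Equiv.prodCongr Fin.revPerm Fin.revPerm)) ?_
  rintro ⟨a, b⟩
  simp [Fin.rev_lt_rev]

/-! ### Column determinants with permuted columns -/

/-- The prefix and the suffix of a product do not see its two adjacent factors `k`, `k + 1`. -/
theorem exists_prod_ofFn_eq_mul {R : Type*} [Monoid R] {N : ℕ} (k : Fin N)
    (f : Fin (N + 1) → R) :
    ∃ U V : R, ∀ g : Fin (N + 1) → R, (∀ x, x ≠ k.castSucc → x ≠ k.succ → g x = f x) →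
      (List.ofFn g).prod = U * (g k.castSucc * g k.succ) * V := by
  refine ⟨((List.ofFn f).take k).prod, ((List.ofFn f).drop (k + 2)).prod, fun g hg => ?_⟩
  have hk := k.isLt
  have h1 : (List.ofFn g).take k = (List.ofFn f).take k := by
    apply List.ext_getElem
    · simp
    · intro i hi _
      simp only [List.length_take, List.length_ofFn] at hi
      simp only [List.getElem_take, List.getElem_ofFn]
      apply hg <;> simp [Fin.ext_iff] <;> omega
  have h2 : (List.ofFn g).drop (k + 2) = (List.ofFn f).drop (k + 2) := by
    apply List.ext_getElem
    · simp
    · intro i hi _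
      simp only [List.getElem_drop, List.getElem_ofFn]
      apply hg <;> simp [Fin.ext_iff] <;> omega
  rw [← h1, ← h2]
  conv_lhs => rw [← List.take_append_drop k (List.ofFn g)]
  rw [List.drop_eq_getElem_cons (by simp), List.drop_eq_getElem_cons (by simp)]
  simp only [List.getElem_ofFn, List.prod_append, List.prod_cons, mul_assoc]
  rfl

section ColDet

variable {K : Type*} [Field K] {R : Type*} [Ring R] [Algebra K R]

/-- The quantum column determinant of the matrix whose `k`-th column is the column `τ k` of `A`:
`∑_σ (-q)^{-l(σ)} A_{σ(1),τ(1)} ⋯ A_{σ(r),τ(r)}`. -/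
noncomputable def colDet (q : K) {r : ℕ} (A : Matrix (Fin r) (Fin r) R)
    (τ : Equiv.Perm (Fin r)) : R :=
  ∑ σ : Equiv.Perm (Fin r), (-q) ^ (-(permLength σ : ℤ)) •
    (List.ofFn fun k => A (σ k) (τ k)).prod

/-- The cross relations of a quantum Manin matrix: the quantum determinant of a `2 × 2`
submatrix may be expanded along its columns in either order. -/
def IsCrossManin (q : K) {r : ℕ} (A : Matrix (Fin r) (Fin r) R) : Prop :=
  ∀ i k j l : Fin r, i < k → j < l →
    A i j * A k l - q⁻¹ • (A k j * A i l) = A k l * A i j - q • (A i l * A k j)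

theorem colDet_mul_swap {q : K} (hq : q ≠ 0) {N : ℕ}
    {A : Matrix (Fin (N + 1)) (Fin (N + 1)) R} (hA : IsCrossManin q A)
    (τ : Equiv.Perm (Fin (N + 1))) (k : Fin N) (h : τ k.castSucc < τ k.succ) :
    colDet q A τ = (-q) • colDet q A (τ * Equiv.swap k.castSucc k.succ) := by
  classical
  set s := Equiv.swap k.castSucc k.succ
  have hk : s k.castSucc = k.succ := Equiv.swap_apply_left _ _
  have hk' : s k.succ = k.castSucc := Equiv.swap_apply_right _ _
  have hx : ∀ x, x ≠ k.castSucc → x ≠ k.succ → s x = x :=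
    fun x => Equiv.swap_apply_of_ne_of_ne
  have hss : s * s = 1 := Equiv.swap_mul_self _ _
  have hq' : -q ≠ 0 := neg_ne_zero.mpr hq
  -- A sum over all permutations is a sum over the pairs `σ, σ * s` with `σ k < σ (k + 1)`.
  have pair : ∀ F : Equiv.Perm (Fin (N + 1)) → R, ∑ σ, F σ =
      ∑ σ ∈ Finset.univ.filter (fun σ : Equiv.Perm (Fin (N + 1)) => σ k.castSucc < σ k.succ),
        (F σ + F (σ * s)) := by
    intro F
    rw [Finset.sum_add_distrib, ← Finset.sum_filter_add_sum_filter_not Finset.univ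
      (fun σ : Equiv.Perm (Fin (N + 1)) => σ k.castSucc < σ k.succ)]
    congr 1
    refine Finset.sum_equiv (Equiv.mulRight s) (fun σ => ?_) (fun σ _ => ?_)
    · simp only [Finset.mem_filter, Finset.mem_univ, true_and, Equiv.coe_mulRight,
        Equiv.Perm.mul_apply, hk, hk', not_lt]
      refine ⟨fun h => lt_of_le_of_ne h fun he => ?_, le_of_lt⟩
      exact (Fin.castSucc_lt_succ (i := k)).ne (σ.injective he).symm
    · simp [mul_assoc, hss]
  unfold colDet
  rw [pair, pair, Finset.smul_sum]
  refine Finset.sum_congr rfl fun σ hσ => ?_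
  have hσ' : σ k.castSucc < σ k.succ := by simpa using hσ
  obtain ⟨U, V, hUV⟩ := exists_prod_ofFn_eq_mul k fun x => A (σ x) (τ x)
  rw [hUV _ fun x h1 h2 => rfl,
    hUV (fun x => A ((σ * s) x) (τ x)) fun x h1 h2 => by simp [hx x h1 h2],
    hUV (fun x => A (σ x) ((τ * s) x)) fun x h1 h2 => by simp [hx x h1 h2],
    hUV (fun x => A ((σ * s) x) ((τ * s) x)) fun x h1 h2 => by simp [hx x h1 h2]]
  simp only [Equiv.Perm.mul_apply, hk, hk']
  have hw : (-q) ^ (-(permLength (σ * s) : ℤ)) = (-q) ^ (-(permLength σ : ℤ)) * (-q⁻¹) := by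
    rw [permLength_mul_swap σ k hσ', Nat.cast_succ, neg_add, zpow_add₀ hq', zpow_neg_one,
      inv_neg]
  rw [hw]
  generalize (-q) ^ (-(permLength σ : ℤ)) = w
  have hm := congrArg (fun z => w • (U * z * V)) (hA _ _ _ _ hσ' h)
  have hqq : -q * (w * -q⁻¹) = w := by field_simp
  simp only [mul_sub, sub_mul, smul_sub, mul_smul_comm, smul_mul_assoc, smul_smul] at hm
  rw [smul_add, smul_smul, smul_smul, hqq]
  rw [mul_neg, neg_smul, ← sub_eq_add_neg, hm, neg_mul, neg_smul, mul_comm q w]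
  abel

theorem colDet_eq {q : K} (hq : q ≠ 0) {r : ℕ}
    {A : Matrix (Fin r) (Fin r) R} (hA : IsCrossManin q A) (τ : Equiv.Perm (Fin r)) :
    colDet q A τ = (-q) ^ (-(permLength τ : ℤ)) • colDet q A 1 := by
  have hq' : -q ≠ 0 := neg_ne_zero.mpr hq
  cases r with
  | zero => simp [Subsingleton.elim τ 1, permLength_one]
  | succ N =>
    have hτ : τ ∈ Submonoid.closure
        (Set.range fun i : Fin N => Equiv.swap i.castSucc i.succ) := by
      rw [Equiv.Perm.mclosure_swap_castSucc_succ]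
      trivial
    induction hτ using Submonoid.closure_induction_right with
    | one => simp [permLength_one]
    | mul_right τ _ s hs ih =>
      obtain ⟨k, rfl⟩ := hs
      have hne : τ k.castSucc ≠ τ k.succ := fun he =>
        (Fin.castSucc_lt_succ (i := k)).ne (τ.injective he)
      rcases lt_or_gt_of_ne hne with h | h
      · have h1 := colDet_mul_swap hq hA τ k h
        rw [ih, ← inv_smul_eq_iff₀ hq', smul_smul] at h1
        rw [← h1, permLength_mul_swap τ k h, Nat.cast_succ, neg_add_rev, zpow_add₀ hq',
          zpow_neg_one]
      · -- Here `τ * s` has one inversion less, and `τ = (τ * s) * s`.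
        have hmul : τ * Equiv.swap k.castSucc k.succ * Equiv.swap k.castSucc k.succ = τ := by
          rw [mul_assoc, Equiv.swap_mul_self, mul_one]
        have h' : (τ * Equiv.swap k.castSucc k.succ) k.castSucc <
            (τ * Equiv.swap k.castSucc k.succ) k.succ := by simpa using h
        have h1 := colDet_mul_swap hq hA _ k h'
        have h2 := permLength_mul_swap _ k h'
        rw [hmul] at h1 h2
        rw [h1, ih, h2, smul_smul, Nat.cast_succ, neg_add_rev, zpow_add₀ hq', zpow_neg_one,
          mul_inv_cancel_left₀ hq']

/-- The product of columns may be taken in the opposite order, with `q` replaced by `q⁻¹`. -/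
theorem sum_reverse_eq_colDet {q : K} (hq : q ≠ 0) {r : ℕ}
    {A : Matrix (Fin r) (Fin r) R} (hA : IsCrossManin q A) :
    ∑ σ : Equiv.Perm (Fin r), (-q) ^ (permLength σ : ℤ) •
      (List.ofFn fun k : Fin r => A (σ k.rev) k.rev).prod = colDet q A 1 := by
  have hq' : -q ≠ 0 := neg_ne_zero.mpr hq
  have h := colDet_eq hq hA Fin.revPerm
  rw [zpow_neg, eq_inv_smul_iff₀ (zpow_ne_zero _ hq')] at h
  rw [← h, colDet, Finset.smul_sum]
  refine Finset.sum_equiv (Equiv.mulRight Fin.revPerm) (by simp) fun σ _ => ?_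
  rw [smul_smul, ← zpow_add₀ hq', ← permLength_add_permLength_mul_rev σ, Equiv.coe_mulRight]
  simp

end ColDet

/-! ### Relations in the Hopf envelope -/

section Envelope

variable {K : Type*} [Field K] (q : K) (m n : ℕ)

/-- The image of `M̄ₜ` in the Hopf envelope. -/
noncomputable def levelMatrix (t : ℕ) :
    Matrix (Fin (m + n)) (Fin (m + n)) (QuantumSuperHopf q m n) :=
  (freeGen K m n t).map (hopfProj q m n)

variable {q m n}

theorem hopfProj_eq_of_rel {x y : FreeAlgebra K (ℕ × Fin (m + n) × Fin (m + n))}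
    (h : HopfRel q m n x y) : hopfProj q m n x = hopfProj q m n y :=
  RingQuot.mkAlgHom_rel K h

theorem superTranspose_map {R S F : Type*} [Ring R] [Ring S] [FunLike F R S] [RingHomClass F R S]
    (f : F) (A : Matrix (Fin (m + n)) (Fin (m + n)) R) :
    (superTranspose m n A).map f = superTranspose m n (A.map f) := by
  ext i j
  simp [superTranspose]

variable (q m n)

theorem levelMatrix_add_two (t : ℕ) : levelMatrix q m n (t + 2) = levelMatrix q m n t := by
  ext i j
  exact (hopfProj_eq_of_rel (HopfRel.periodic t 1 i j)).symm

theorem levelMatrix_zero_mul_one : levelMatrix q m n 0 * levelMatrix q m n 1 = 1 := by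
  ext i j
  have h := hopfProj_eq_of_rel (HopfRel.mulInv (q := q) 0 i j)
  simpa [levelMatrix, Matrix.mul_apply, Matrix.one_apply, apply_ite] using h

theorem levelMatrix_one_mul_zero : levelMatrix q m n 1 * levelMatrix q m n 0 = 1 := by
  ext i j
  have h := hopfProj_eq_of_rel (HopfRel.invMul (q := q) 0 i j)
  simpa [levelMatrix, Matrix.mul_apply, Matrix.one_apply, apply_ite] using h

theorem superTranspose_one_mul_zero :
    superTranspose m n (levelMatrix q m n 1) * superTranspose m n (levelMatrix q m n 0) = 1 := by
  rw [← levelMatrix_add_two q m n 0, levelMatrix, levelMatrix, ← superTranspose_map,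
    ← superTranspose_map]
  ext i j
  have h := hopfProj_eq_of_rel (HopfRel.mulInv (q := q) 1 i j)
  simpa [Matrix.mul_apply, Matrix.one_apply, apply_ite] using h

theorem superTranspose_zero_mul_one :
    superTranspose m n (levelMatrix q m n 0) * superTranspose m n (levelMatrix q m n 1) = 1 := by
  rw [← levelMatrix_add_two q m n 0, levelMatrix, levelMatrix, ← superTranspose_map,
    ← superTranspose_map]
  ext i j
  have h := hopfProj_eq_of_rel (HopfRel.invMul (q := q) 1 i j)
  simpa [Matrix.mul_apply, Matrix.one_apply, apply_ite] using h

theorem inverse_levelMatrix_zero :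
    Ring.inverse (levelMatrix q m n 0) = levelMatrix q m n 1 :=
  Ring.inverse_unit (⟨_, _, levelMatrix_zero_mul_one q m n, levelMatrix_one_mul_zero q m n⟩ :
    (Matrix (Fin (m + n)) (Fin (m + n)) (QuantumSuperHopf q m n))ˣ)

theorem parity_castAdd (i : Fin m) : parity m n (Fin.castAdd n i) = 0 := by
  simp [parity]

theorem parity_natAdd (i : Fin n) : parity m n (Fin.natAdd m i) = 1 := by
  simp [parity]

theorem eps_of_lt {N : ℕ} {a b : Fin N} (h : a < b) : eps a b = -1 := by
  rw [eps, Int.sign_eq_neg_one_iff_neg]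
  have : (a : ℕ) < b := h
  omega

theorem eps_of_gt {N : ℕ} {a b : Fin N} (h : b < a) : eps a b = 1 := by
  rw [eps, Int.sign_eq_one_iff_pos]
  have : (b : ℕ) < a := h
  omega

theorem levelMatrix_cross (t : ℕ) (i j k l : Fin (m + n)) :
    levelMatrix q m n t i j * levelMatrix q m n t k l -
      (levelParam q t ^ (eps i k + eps l j) *
          (-1) ^ ((parity m n i + parity m n j) * (parity m n k + parity m n l))) •
        (levelMatrix q m n t k l * levelMatrix q m n t i j) =
    (levelParam q t ^ eps i k *
          (-1) ^ (parity m n i * parity m n k + parity m n j * parity m n k +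
            parity m n i * parity m n j)) •
        (levelMatrix q m n t k j * levelMatrix q m n t i l) -
      (levelParam q t ^ eps l j *
          (-1) ^ (parity m n j * parity m n k + parity m n j * parity m n l +
            parity m n k * parity m n l)) •
        (levelMatrix q m n t i l * levelMatrix q m n t k j) := by
  have h := hopfProj_eq_of_rel (HopfRel.cross (q := q) t i j k l)
  simp only [map_sub, map_smul, map_mul] at h
  exact h

theorem isCrossManin_even :
    IsCrossManin q (Matrix.of fun i j : Fin m =>
      levelMatrix q m n 0 (Fin.castAdd n i) (Fin.castAdd n j)) := by
  intro i k j l hik hjl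
  have h := levelMatrix_cross q m n 0 (Fin.castAdd n i) (Fin.castAdd n j) (Fin.castAdd n k)
    (Fin.castAdd n l)
  rw [eps_of_lt (show Fin.castAdd n i < Fin.castAdd n k from hik),
    eps_of_gt (show Fin.castAdd n j < Fin.castAdd n l from hjl)] at h
  simp only [parity_castAdd, levelParam, Even.zero, if_true] at h
  norm_num at h
  simp only [Matrix.of_apply]
  linear_combination (norm := module) h

/-- The odd-odd block of `M⁻¹`, a Manin matrix for `q⁻¹` up to parity, becomes one for `q` after
transposition. -/
theorem isCrossManin_odd :
    IsCrossManin q (Matrix.of fun i j : Fin n =>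
      levelMatrix q m n 1 (Fin.natAdd m j) (Fin.natAdd m i)) := by
  intro i k j l hik hjl
  have h := levelMatrix_cross q m n 1 (Fin.natAdd m j) (Fin.natAdd m i) (Fin.natAdd m l)
    (Fin.natAdd m k)
  rw [eps_of_lt (show Fin.natAdd m j < Fin.natAdd m l by simpa using hjl),
    eps_of_gt (show Fin.natAdd m i < Fin.natAdd m k by simpa using hik)] at h
  simp only [parity_natAdd, levelParam] at h
  norm_num at h
  simp only [Matrix.of_apply]
  linear_combination (norm := module) h

/-! ### The `Π`-transpose -/

/-- The reversal of the indices, from type `n|m` to type `m|n`. -/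
def revIndex : Fin (n + m) ≃ Fin (m + n) :=
  (finCongr (Nat.add_comm n m)).trans Fin.revPerm

theorem parity_revIndex (i : Fin (n + m)) :
    parity m n (revIndex m n i) + parity n m i = 1 := by
  have := i.isLt
  simp only [parity, revIndex, Equiv.trans_apply, finCongr_apply, Fin.revPerm_apply, Fin.val_rev,
    Fin.val_cast]
  split_ifs <;> omega

/-- Reversing the indices exchanges the parities, so the two supertransposes differ by
conjugation with the diagonal matrix of parity signs. -/
theorem superTranspose_piTranspose {R : Type*} [Ring R]
    (A : Matrix (Fin (m + n)) (Fin (m + n)) R) :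
    superTranspose n m (piTranspose m n A) =
      (Matrix.diagonal (fun i => (-1 : R) ^ parity m n i) * superTranspose m n A *
        Matrix.diagonal (fun i => (-1 : R) ^ parity m n i)).submatrix
          (revIndex m n) (revIndex m n) := by
  ext i j
  have hi := parity_revIndex m n i
  have hj := parity_revIndex m n j
  have he : ∀ x, (Fin.cast (Nat.add_comm n m) x).rev = revIndex m n x := fun _ => rfl
  simp only [superTranspose, piTranspose, Matrix.of_apply, Matrix.submatrix_apply,
    Matrix.mul_diagonal, Matrix.diagonal_mul, he]
  rcases Nat.eq_zero_or_pos (parity n m i) with h | h <;>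
    rcases Nat.eq_zero_or_pos (parity n m j) with h' | h'
  · rw [h, h', show parity m n (revIndex m n i) = 1 by omega,
      show parity m n (revIndex m n j) = 1 by omega]
    simp
  · rw [h, show parity n m j = 1 by omega, show parity m n (revIndex m n i) = 1 by omega,
      show parity m n (revIndex m n j) = 0 by omega]
    simp
  · rw [h', show parity n m i = 1 by omega, show parity m n (revIndex m n i) = 0 by omega,
      show parity m n (revIndex m n j) = 1 by omega]
    simp
  · rw [show parity n m j = 1 by omega, show parity n m i = 1 by omega,
      show parity m n (revIndex m n i) = 0 by omega,
      show parity m n (revIndex m n j) = 0 by omega]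
    simp

theorem superTranspose_piTranspose_mul {R : Type*} [Ring R]
    {A B : Matrix (Fin (m + n)) (Fin (m + n)) R}
    (h : superTranspose m n A * superTranspose m n B = 1) :
    superTranspose n m (piTranspose m n A) * superTranspose n m (piTranspose m n B) = 1 := by
  have hD : Matrix.diagonal (fun i => (-1 : R) ^ parity m n i) *
      Matrix.diagonal (fun i => (-1 : R) ^ parity m n i) = 1 := by
    simp [Matrix.diagonal_mul_diagonal, ← pow_add, ← Pi.one_def]
  rw [superTranspose_piTranspose, superTranspose_piTranspose, Matrix.submatrix_mul_equiv]
  set D := Matrix.diagonal (fun i => (-1 : R) ^ parity m n i)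
  have : D * superTranspose m n A * D * (D * superTranspose m n B * D) =
      D * (superTranspose m n A * (D * D) * superTranspose m n B) * D := by
    simp only [mul_assoc]
  rw [this, hD, mul_one, h, mul_one, hD, Matrix.submatrix_one_equiv]

theorem revIndex_natAdd (j : Fin m) : revIndex m n (Fin.natAdd n j) = Fin.castAdd n j.rev := by
  ext
  simp [revIndex]
  omega

theorem revIndex_castAdd (j : Fin n) : revIndex m n (Fin.castAdd m j) = Fin.natAdd m j.rev := by
  ext
  simp [revIndex]
  omega

theorem superTranspose_piTranspose_odd {R : Type*} [Ring R]
    (A : Matrix (Fin (m + n)) (Fin (m + n)) R) (i j : Fin m) :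
    superTranspose n m (piTranspose m n A) (Fin.natAdd n i) (Fin.natAdd n j) =
      A (Fin.castAdd n j.rev) (Fin.castAdd n i.rev) := by
  rw [← revIndex_natAdd, ← revIndex_natAdd]
  simp [superTranspose, parity_natAdd, piTranspose, revIndex]

theorem superTranspose_piTranspose_even {R : Type*} [Ring R]
    (A : Matrix (Fin (m + n)) (Fin (m + n)) R) (i j : Fin n) :
    superTranspose n m (piTranspose m n A) (Fin.castAdd m i) (Fin.castAdd m j) =
      A (Fin.natAdd m j.rev) (Fin.natAdd m i.rev) := by
  rw [← revIndex_castAdd, ← revIndex_castAdd]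
  simp [superTranspose, parity_castAdd, piTranspose, revIndex]

/-! ### The two factors of the Berezinians -/

variable {q}

theorem oddDet_superTranspose_piTranspose {R : Type*} [Ring R] [Algebra K R] (hq : q ≠ 0)
    (A : Matrix (Fin (m + n)) (Fin (m + n)) R)
    (hA : IsCrossManin q
      (Matrix.of fun i j : Fin m => A (Fin.castAdd n i) (Fin.castAdd n j))) :
    oddDet q⁻¹ n m (superTranspose n m (piTranspose m n A)) = evenDet q m n A := by
  have h := sum_reverse_eq_colDet hq hA
  rw [colDet] at h
  refine Eq.trans ?_ h
  refine Finset.sum_equiv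
    ((Equiv.mulLeft Fin.revPerm).trans (Equiv.mulRight Fin.revPerm)) (by simp) fun ρ _ => ?_
  simp [superTranspose_piTranspose_odd, permLength_rev_mul_mul_rev, ← inv_neg]

theorem evenDet_superTranspose_piTranspose {R : Type*} [Ring R] [Algebra K R] (hq : q ≠ 0)
    (A : Matrix (Fin (m + n)) (Fin (m + n)) R)
    (hA : IsCrossManin q
      (Matrix.of fun i j : Fin n => A (Fin.natAdd m j) (Fin.natAdd m i))) :
    evenDet q⁻¹ n m (superTranspose n m (piTranspose m n A)) = oddDet q m n A := by
  have h := sum_reverse_eq_colDet hq hA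
  rw [colDet] at h
  refine Eq.trans ?_ h
  refine Finset.sum_equiv
    ((Equiv.mulLeft Fin.revPerm).trans (Equiv.mulRight Fin.revPerm)) (by simp) fun ρ _ => ?_
  simp [superTranspose_piTranspose_even, permLength_rev_mul_mul_rev, ← inv_neg]

end Envelope

theorem corollary4p5 {K : Type*} [Field K] (q : K) (hq : q ≠ 0) (m n : ℕ) :
    IsUnit (genMatrix q m n) ∧
    IsUnit (superTranspose n m (piTranspose m n (Ring.inverse (genMatrix q m n)))) ∧
    qBer q m n (genMatrix q m n) =
      qInvBer q n m (superTranspose n m (piTranspose m n (Ring.inverse (genMatrix q m n)))) := by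
  have hgen : genMatrix q m n = levelMatrix q m n 0 := rfl
  let u : (Matrix (Fin (n + m)) (Fin (n + m)) (QuantumSuperHopf q m n))ˣ :=
    ⟨superTranspose n m (piTranspose m n (levelMatrix q m n 1)),
      superTranspose n m (piTranspose m n (levelMatrix q m n 0)),
      superTranspose_piTranspose_mul m n (superTranspose_one_mul_zero q m n),
      superTranspose_piTranspose_mul m n (superTranspose_zero_mul_one q m n)⟩
  have hinv : Ring.inverse (superTranspose n m (piTranspose m n (levelMatrix q m n 1))) =
      superTranspose n m (piTranspose m n (levelMatrix q m n 0)) := Ring.inverse_unit u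
  rw [hgen, inverse_levelMatrix_zero]
  refine ⟨⟨⟨_, _, levelMatrix_zero_mul_one q m n, levelMatrix_one_mul_zero q m n⟩, rfl⟩,
    ⟨u, rfl⟩, ?_⟩
  rw [qBer, qInvBer, inverse_levelMatrix_zero, hinv,
    oddDet_superTranspose_piTranspose m n hq _ (isCrossManin_even q m n),
    evenDet_superTranspose_piTranspose m n hq _ (isCrossManin_odd q m n)]
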